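/- All graphs are finite, simple and undirected. A connected graph $G$ is $k$-connected if deleting fewer than $k$ vertices never disconnects it. For an edge colouring of $G$ (not necessarily proper), a rainbow path is a path no two of whose edges have the same colour, and the colouring is a rainbow colouring if every two vertices of $G$ are joined by a rainbow path. The rainbow connection number $rc(G)$ is the least number of colours in a rainbow colouring of $G$, and $\mathrm{diam}(G)$ is the largest distance between two vertices of $G$. Theorem. Let $G$ be a $\kappa$-connected graph on $n$ vertices with $\mathrm{diam}(G) = \frac{n}{\kappa} - c$, where $c \ge 0$ is a real number. (i) If $\kappa = 3$, then $rc(G) \le \frac{n}{3} + 11c + 6$. (ii) If $\kappa = 4$, then $rc(G) \le \frac{n}{4} + 15c + 18$. -/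

import Mathlib

namespace SimpleGraph

variable {V : Type*}

/-- `G` is `k`-(vertex-)connected: it is connected, and deleting fewer than `k` vertices does not
disconnect it. No lower bound on the number of vertices is imposed, so a complete graph is
`k`-connected for every `k`; for all other graphs this agrees with the convention that also asks
for more than `k` vertices. -/
def IsVertexConnected (G : SimpleGraph V) (k : ℕ) : Prop :=
  G.Connected ∧ ∀ S : Finset V, S.card < k → (G.induce ((S : Set V)ᶜ)).Preconnected

/-- Given an edge colouring `C` of `G` (not necessarily proper), the walk `p` is a rainbow path:
it is a path, and no two of its edges have the same colour. -/
def IsRainbowPath {G : SimpleGraph V} {K : Type*} (C : G.edgeSet → K) {u v : V}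
    (p : G.Walk u v) : Prop :=
  p.IsPath ∧ ∀ e f : G.edgeSet, (e : Sym2 V) ∈ p.edges → (f : Sym2 V) ∈ p.edges → C e = C f → e = f

/-- The edge colouring `C` is a rainbow colouring of `G`: every pair of vertices is connected by
a rainbow path. -/
def IsRainbowColoring {G : SimpleGraph V} {K : Type*} (C : G.edgeSet → K) : Prop :=
  ∀ u v : V, ∃ p : G.Walk u v, IsRainbowPath C p

/-- The rainbow connection number of `G`: the least `k` such that `G` has a rainbow colouring
with colours from a set of size `k`. -/
noncomputable def rainbowConnectionNumber (G : SimpleGraph V) : ℕ :=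
  sInf {k : ℕ | ∃ C : G.edgeSet → Fin k, IsRainbowColoring C}

/-- On a finite connected graph the minimum defining the rainbow connection number is attained. -/
theorem exists_isRainbowColoring_rainbowConnectionNumber [Finite V] {G : SimpleGraph V}
    (hG : G.Connected) :
    ∃ C : G.edgeSet → Fin G.rainbowConnectionNumber, IsRainbowColoring C := by
  classical
  have hne : {k : ℕ | ∃ C : G.edgeSet → Fin k, IsRainbowColoring C}.Nonempty := by
    obtain ⟨k, ⟨C⟩⟩ := Finite.exists_equiv_fin G.edgeSet
    refine ⟨k, C, fun u v => ?_⟩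
    obtain ⟨p, hp⟩ := hG.exists_isPath u v
    exact ⟨p, hp, fun e f _ _ h => C.injective h⟩
  exact Nat.sInf_mem hne

end SimpleGraph

/-!
Let `u`, `v` be at distance `diam G ≥ 2`. By Menger's theorem they are joined by `κ` internally
disjoint paths; choose these with least total length, so that each of them is geodesic among its
own vertices and the *outer* vertices, those on none of the paths. Each path has at least
`diam G - 1` internal vertices, hence the number `r` of outer vertices and the excess length of the
longest path are bounded in terms of `c`.

Number the edges of the paths with colours less than `M`, the length of a longest path, increasingly
from `u` on two of the paths and decreasingly on the others: two vertices on paths of opposite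
directions are then joined by a rainbow path through `u` or through `v`. All other edges receive the
colour `M`, except that a few edges get private colours. These are the edges of a forest that
hangs the outer vertices on the paths, and one path edge for each internal vertex which cannot leave
its path through one edge followed by a forest edge. Every such stuck vertex is adjacent to an outer
vertex hanging on its own path, and an outer vertex has at most three neighbours on a geodesic, so
at most `4 r` colours are private. Since at most two paths have the same direction, one crossing to
another path is enough to connect any two vertices.
-/

namespace RainbowConnection

open SimpleGraph

variable {V ι K : Type*} {G : SimpleGraph V} {u v : V}

/-! ### Menger's theorem -/

/-- A family of walks from `u` to `v`, no two of which share a vertex other than `u` and `v`. -/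
def InternallyDisjoint (p : ι → G.Walk u v) : Prop :=
  Pairwise fun a b => ∀ x ∈ (p a).support, x ∈ (p b).support → x = u ∨ x = v

/-- The allowed steps of a permutation of tokens (`Sum.inl`) and vertices (`Sum.inr`) that encodes
internally disjoint walks from `u` to `v`: a token enters a neighbour of `u`, a vertex stays in
place or moves to a neighbour, both different from `u` and `v`, and a neighbour of `v` may return to
any token. The walks are the stretches of the orbits between consecutive tokens. -/
def LinkStep (G : SimpleGraph V) (u v : V) : ι ⊕ V → ι ⊕ V → Prop
  | .inl _, .inl _ => False
  | .inl _, .inr w => G.Adj u w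
  | .inr w, .inl _ => G.Adj w v
  | .inr w, .inr w' => w = w' ∨ G.Adj w w' ∧ w ≠ u ∧ w ≠ v ∧ w' ≠ u ∧ w' ≠ v

theorem le_card_of_boundary_subset {k : ℕ}
    (hsep : ∀ S : Finset V, u ∉ S → v ∉ S → S.card < k →
      ∃ p : G.Walk u v, ∀ x ∈ p.support, x ∉ S)
    {A : Set V} (hu : u ∈ A) (hv : v ∉ A) {T : Finset V} (huT : u ∉ T) (hvT : v ∉ T)
    (hT : ∀ x ∈ A, ∀ y ∉ A, G.Adj x y → y ∈ T) : k ≤ T.card := by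
  by_contra! hlt
  obtain ⟨p, hp⟩ := hsep T huT hvT hlt
  obtain ⟨d, hd, hfst, hsnd⟩ := p.exists_boundary_dart A hu hv
  exact hp _ (p.dart_snd_mem_support_of_mem_darts hd) (hT _ hfst _ hsnd d.adj)

open Classical in
theorem card_le_card_linkStep [Fintype V] [Fintype ι] (hne : u ≠ v) (huv : ¬ G.Adj u v)
    (hsep : ∀ S : Finset V, u ∉ S → v ∉ S → S.card < Fintype.card ι →
      ∃ p : G.Walk u v, ∀ x ∈ p.support, x ∉ S) (X : Finset (ι ⊕ V)) :
    X.card ≤ (Finset.univ.filter fun y => ∃ x ∈ X, LinkStep G u v x y).card := by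
  set N := Finset.univ.filter fun y => ∃ x ∈ X, LinkStep G u v x y with hN
  have mem_N {y} : y ∈ N ↔ ∃ x ∈ X, LinkStep G u v x y := by simp [hN]
  have hstay : X.toRight ⊆ N.toRight := fun y hy =>
    Finset.mem_toRight.2 (mem_N.2 ⟨_, Finset.mem_toRight.1 hy, Or.inl rfl⟩)
  rw [← X.card_toLeft_add_card_toRight, ← N.card_toLeft_add_card_toRight]
  by_cases hreturn : ∃ y, Sum.inr y ∈ X ∧ G.Adj y v
  · obtain ⟨y, hy, hyv⟩ := hreturn
    have htokens : X.toLeft ⊆ N.toLeft := fun j _ => Finset.mem_toLeft.2 (mem_N.2 ⟨_, hy, hyv⟩)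
    exact add_le_add (Finset.card_le_card htokens) (Finset.card_le_card hstay)
  obtain hempty | ⟨i, hi⟩ := X.toLeft.eq_empty_or_nonempty
  · rw [hempty, Finset.card_empty, zero_add]
    exact (Finset.card_le_card hstay).trans (Nat.le_add_left _ _)
  rw [Finset.mem_toLeft] at hi
  have hnew : Fintype.card ι ≤ (N.toRight \ (X.toRight ∪ {u, v})).card := by
    refine le_card_of_boundary_subset hsep (A := {x | x = u ∨ Sum.inr x ∈ X ∧ x ≠ v})
      (Or.inl rfl) (by simp [hne.symm]) (by simp) (by simp) ?_
    intro x hx y hy hxy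
    obtain ⟨hyu, hyX⟩ := not_or.1 hy
    have hyv : y ≠ v := by
      rintro rfl
      obtain rfl | hx := hx
      exacts [huv hxy, hreturn ⟨x, hx.1, hxy⟩]
    have hyN : Sum.inr y ∈ N := by
      by_cases hxu : x = u
      · exact mem_N.2 ⟨_, hi, show G.Adj u y from hxu ▸ hxy⟩
      · obtain ⟨hxX, hxv⟩ := hx.resolve_left hxu
        exact mem_N.2 ⟨_, hxX, Or.inr ⟨hxy, hxu, hxv, hyu, hyv⟩⟩
    have hyX' : Sum.inr y ∉ X := fun h => hyX ⟨h, hyv⟩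
    simp [hyN, hyX', hyu, hyv]
  have hdisj : Disjoint (N.toRight \ (X.toRight ∪ {u, v})) X.toRight :=
    Finset.sdiff_disjoint.mono_right Finset.subset_union_left
  have hunion := Finset.card_le_card (Finset.union_subset Finset.sdiff_subset hstay :
    N.toRight \ (X.toRight ∪ {u, v}) ∪ X.toRight ⊆ N.toRight)
  rw [Finset.card_union_of_disjoint hdisj] at hunion
  have htokens : X.toLeft.card ≤ Fintype.card ι := Finset.card_le_univ _
  omega

theorem exists_injective_linkStep [Finite V] [Fintype ι] (hne : u ≠ v) (huv : ¬ G.Adj u v)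
    (hsep : ∀ S : Finset V, u ∉ S → v ∉ S → S.card < Fintype.card ι →
      ∃ p : G.Walk u v, ∀ x ∈ p.support, x ∉ S) :
    ∃ f : ι ⊕ V → ι ⊕ V, Function.Injective f ∧ ∀ x, LinkStep G u v x (f x) := by
  classical
  have := Fintype.ofFinite V
  exact (Fintype.all_card_le_filter_rel_iff_exists_injective _).1
    (card_le_card_linkStep hne huv hsep)

/-- The vertices on the orbit of the token `i` under `f` before the first return to a token. -/
inductive Visits (f : ι ⊕ V → ι ⊕ V) (i : ι) : V → Prop
  | start {x : V} : f (.inl i) = .inr x → Visits f i x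
  | step {x y : V} : Visits f i x → f (.inr x) = .inr y → Visits f i y

theorem Visits.unique {f : ι ⊕ V → ι ⊕ V} (hf : Function.Injective f) {i j : ι} {x : V}
    (hi : Visits f i x) (hj : Visits f j x) : i = j := by
  induction hi with
  | start hix =>
    cases hj with
    | start hjx => exact Sum.inl_injective (hf (hix.trans hjx.symm))
    | step _ hyx => exact absurd (hf (hix.trans hyx.symm)) Sum.inl_ne_inr
  | step _ hyx ih =>
    cases hj with
    | start hjx => exact absurd (hf (hyx.trans hjx.symm)) Sum.inr_ne_inl
    | step hz hzx => exact ih (Sum.inr_injective (hf (hyx.trans hzx.symm)) ▸ hz)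

theorem Visits.exists_eq_inl [Finite V] [Finite ι] {f : ι ⊕ V → ι ⊕ V} (hf : Function.Injective f)
    {i : ι} (hi : ∀ j, f (.inl i) ≠ .inl j) :
    ∃ x, Visits f i x ∧ ∃ j, f (.inr x) = .inl j := by
  by_contra! hnever
  have hvisits (n : ℕ) : ∃ x, Visits f i x ∧ f^[n + 1] (.inl i) = .inr x := by
    induction n with
    | zero =>
      rcases hx : f (.inl i) with j | x
      exacts [absurd hx (hi j), ⟨x, .start hx, hx⟩]
    | succ n ih =>
      obtain ⟨x, hx, hfx⟩ := ih
      rw [Function.iterate_succ_apply', hfx]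
      rcases hy : f (.inr x) with j | y
      exacts [absurd hy (hnever x hx j), ⟨y, hx.step hy, rfl⟩]
  obtain ⟨n, hn, hperiod⟩ := hf.mem_periodicPts (Sum.inl i)
  obtain ⟨m, rfl⟩ := Nat.exists_eq_add_of_lt hn
  obtain ⟨x, -, hx⟩ := hvisits m
  rw [zero_add, Function.IsPeriodicPt, Function.IsFixedPt, hx] at hperiod
  exact Sum.inr_ne_inl hperiod

theorem Visits.exists_walk {f : ι ⊕ V → ι ⊕ V} (hf : ∀ x, LinkStep G u v x (f x)) {i : ι} {x : V}
    (hx : Visits f i x) : ∃ q : G.Walk u x, ∀ y ∈ q.support, y = u ∨ Visits f i y := by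
  induction hx with
  | @start x hx =>
    have hux : G.Adj u x := by simpa only [hx] using! hf (.inl i)
    exact ⟨hux.toWalk, by simp [Visits.start hx]⟩
  | @step x y hx hy ih =>
    obtain ⟨q, hq⟩ := ih
    have hxy : LinkStep G u v (.inr x : ι ⊕ V) (.inr y) := hy ▸ hf (.inr x)
    obtain rfl | hxy := hxy
    · exact ⟨q, hq⟩
    · refine ⟨q.concat hxy.1, fun z hz => ?_⟩
      rw [Walk.support_concat, List.mem_append, List.mem_singleton] at hz
      obtain hz | rfl := hz
      exacts [hq z hz, Or.inr (hx.step hy)]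

theorem exists_internallyDisjoint [Finite V] [Fintype ι] (hne : u ≠ v) (huv : ¬ G.Adj u v)
    (hsep : ∀ S : Finset V, u ∉ S → v ∉ S → S.card < Fintype.card ι →
      ∃ p : G.Walk u v, ∀ x ∈ p.support, x ∉ S) :
    ∃ p : ι → G.Walk u v, InternallyDisjoint p := by
  obtain ⟨f, hf, hstep⟩ := exists_injective_linkStep hne huv hsep
  have hwalk (i : ι) : ∃ q : G.Walk u v, ∀ x ∈ q.support, x = u ∨ x = v ∨ Visits f i x := by
    obtain ⟨x, hx, j, hj⟩ :=
      Visits.exists_eq_inl hf fun j hj => (hj ▸ hstep (.inl i) : LinkStep G u v (.inl i) (.inl j))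
    have hxv : G.Adj x v := by simpa only [hj] using! hstep (.inr x)
    obtain ⟨q, hq⟩ := hx.exists_walk hstep
    refine ⟨q.concat hxv, fun y hy => ?_⟩
    rw [Walk.support_concat, List.mem_append, List.mem_singleton] at hy
    obtain hy | rfl := hy
    exacts [(hq y hy).imp_right Or.inr, Or.inr (Or.inl rfl)]
  choose p hp using hwalk
  refine ⟨p, fun a b hab x hxa hxb => ?_⟩
  by_contra! hx
  exact hab (Visits.unique hf (((hp a x hxa).resolve_left hx.1).resolve_left hx.2)
    (((hp b x hxb).resolve_left hx.1).resolve_left hx.2))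

theorem isVertexConnected_mono {k l : ℕ} (hlk : l ≤ k) (hG : G.IsVertexConnected k) :
    G.IsVertexConnected l :=
  ⟨hG.1, fun S hS => hG.2 S (hS.trans_le hlk)⟩

theorem exists_walk_avoiding {k : ℕ} (hG : G.IsVertexConnected k) {S : Finset V} (hu : u ∉ S)
    (hv : v ∉ S) (hS : S.card < k) : ∃ p : G.Walk u v, ∀ x ∈ p.support, x ∉ S := by
  obtain ⟨q⟩ := hG.2 S hS ⟨u, by simpa using hu⟩ ⟨v, by simpa using hv⟩
  refine ⟨q.map (Embedding.induce _).toHom, fun x hx => ?_⟩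
  obtain ⟨y, -, rfl⟩ := List.mem_map.1 ((Walk.support_map _ q).subst (motive := (x ∈ ·)) hx)
  exact fun hy => y.2 (Finset.mem_coe.2 hy)

theorem exists_adj_notMem {k : ℕ} (hG : G.IsVertexConnected k) {S : Finset V} (hS : S.card < k)
    {x t : V} (hx : x ∉ S) (ht : t ∉ S) (hxt : x ≠ t) : ∃ y ∉ S, G.Adj x y := by
  obtain ⟨p, hp⟩ := exists_walk_avoiding hG hx ht hS
  cases p with
  | nil => exact absurd rfl hxt
  | cons hxy p => exact ⟨_, hp _ (by simp), hxy⟩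

/-! ### Geodesic linkages -/

/-- Internally disjoint walks from `u` to `v`, each of which is shortest among the walks from `u` to
`v` whose vertices are its own or lie on none of the walks of the family. -/
structure GeodesicLinkage (G : SimpleGraph V) (u v : V) (ι : Type*) where
  path : ι → G.Walk u v
  internallyDisjoint : InternallyDisjoint path
  length_le : ∀ a (q : G.Walk u v),
    (∀ x ∈ q.support, x ∈ (path a).support ∨ ∀ b, x ∉ (path b).support) →
      (path a).length ≤ q.length

theorem InternallyDisjoint.update [DecidableEq ι] {p : ι → G.Walk u v} (hp : InternallyDisjoint p)
    {a : ι} {q : G.Walk u v}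
    (hq : ∀ x ∈ q.support, x ∈ (p a).support ∨ ∀ b, x ∉ (p b).support) :
    InternallyDisjoint (Function.update p a q) := by
  have hmeet {b x} (hab : a ≠ b) (hxq : x ∈ q.support) (hxb : x ∈ (p b).support) :
      x = u ∨ x = v :=
    hp hab x ((hq x hxq).resolve_right fun h => h b hxb) hxb
  intro b c hbc x hxb hxc
  obtain rfl | hab := eq_or_ne a b
  · rw [Function.update_self] at hxb
    rw [Function.update_of_ne hbc.symm] at hxc
    exact hmeet hbc hxb hxc
  rw [Function.update_of_ne hab.symm] at hxb
  obtain rfl | hac := eq_or_ne a c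
  · rw [Function.update_self] at hxc
    exact hmeet hab hxc hxb
  · rw [Function.update_of_ne hac.symm] at hxc
    exact hp hbc x hxb hxc

theorem InternallyDisjoint.nonempty_geodesicLinkage [Finite ι] {p : ι → G.Walk u v}
    (hp : InternallyDisjoint p) : Nonempty (GeodesicLinkage G u v ι) := by
  classical
  have := Fintype.ofFinite ι
  obtain ⟨p, hp, hmin⟩ := exists_minimalFor_of_wellFoundedLT InternallyDisjoint
    (fun p : ι → G.Walk u v => ∑ a, (p a).length) ⟨p, hp⟩
  refine ⟨⟨p, hp, fun a q hq => ?_⟩⟩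
  by_contra! hlt
  have hsum : ∑ b, (Function.update p a q b).length < ∑ b, (p b).length := by
    refine Finset.sum_lt_sum (fun b _ => ?_) ⟨a, Finset.mem_univ a, by simpa using hlt⟩
    obtain rfl | hba := eq_or_ne b a
    · simpa using hlt.le
    · simp [hba]
  exact (hmin (hp.update hq) hsum.le).not_gt hsum

theorem nonempty_geodesicLinkage [Finite V] [Fintype ι]
    (hG : G.IsVertexConnected (Fintype.card ι)) (hne : u ≠ v) (huv : ¬ G.Adj u v) :
    Nonempty (GeodesicLinkage G u v ι) := by
  obtain ⟨p, hp⟩ := exists_internallyDisjoint (ι := ι) hne huv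
    fun S hu hv hS => exists_walk_avoiding hG hu hv hS
  exact hp.nonempty_geodesicLinkage

namespace GeodesicLinkage

variable (L : GeodesicLinkage G u v ι)

/-- The vertices on none of the paths of the linkage. -/
def Outer (x : V) : Prop := ∀ a, x ∉ (L.path a).support

/-- The internal vertices of the path `a` of the linkage. -/
def Inner (a : ι) (x : V) : Prop := x ∈ (L.path a).support ∧ x ≠ u ∧ x ≠ v

/-- The internal vertices of all the paths, indexed by their positions. -/
def innerVert (s : Σ a, Fin ((L.path a).length - 1)) : V := (L.path s.1).getVert (s.2 + 1)

/-- The edges of all the paths, indexed by their positions. -/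
def pathEdge (s : Σ a, Fin (L.path a).length) : Sym2 V :=
  s((L.path s.1).getVert s.2, (L.path s.1).getVert (s.2 + 1))

theorem getVert_mem_support (a : ι) (i : ℕ) : (L.path a).getVert i ∈ (L.path a).support :=
  Walk.getVert_mem_support _ _

theorem isPath (a : ι) : (L.path a).IsPath := by
  classical
  have hle := L.length_le a (L.path a).bypass fun x hx =>
    Or.inl ((L.path a).support_bypass_subset_support hx)
  exact (L.path a).bypass_eq_self_of_length_le_length_bypass hle ▸ (L.path a).bypass_isPath

theorem getVert_inj {a : ι} {i j : ℕ} (hi : i ≤ (L.path a).length) (hj : j ≤ (L.path a).length) :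
    (L.path a).getVert i = (L.path a).getVert j ↔ i = j :=
  (L.isPath a).getVert_injOn.eq_iff hi hj

theorem le_add_length {a : ι} {i j : ℕ} (hi : i ≤ (L.path a).length) (hj : j ≤ (L.path a).length)
    (q : G.Walk ((L.path a).getVert i) ((L.path a).getVert j))
    (hq : ∀ x ∈ q.support, x ∈ (L.path a).support ∨ L.Outer x) : j ≤ i + q.length := by
  have hle := L.length_le a (((L.path a).take i).append (q.append ((L.path a).drop j)))
    fun x hx => by
      rw [Walk.mem_support_append_iff, Walk.mem_support_append_iff, Walk.support_take,
        Walk.drop_support_eq_support_drop_min] at hx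
      obtain hx | hx | hx := hx
      exacts [Or.inl (List.mem_of_mem_take hx), hq x hx, Or.inl (List.mem_of_mem_drop hx)]
  rw [Walk.length_append, Walk.length_append, Walk.take_length, Walk.drop_length,
    min_eq_left hi] at hle
  omega

theorem le_add_one_of_adj {a : ι} {i j : ℕ} (hi : i ≤ (L.path a).length)
    (hj : j ≤ (L.path a).length)
    (hij : G.Adj ((L.path a).getVert i) ((L.path a).getVert j)) : j ≤ i + 1 :=
  L.le_add_length hi hj hij.toWalk (by simp)

theorem le_add_two_of_adj {w : V} (hw : L.Outer w) {a : ι} {i j : ℕ} (hi : i ≤ (L.path a).length)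
    (hj : j ≤ (L.path a).length) (hwi : G.Adj w ((L.path a).getVert i))
    (hwj : G.Adj w ((L.path a).getVert j)) : j ≤ i + 2 :=
  L.le_add_length hi hj (.cons hwi.symm hwj.toWalk) (by simp [hw])

theorem card_adj_outer_le_three [DecidableRel G.Adj] {w : V} (hw : L.Outer w) (a : ι) :
    ((Finset.range ((L.path a).length + 1)).filter fun i =>
      G.Adj w ((L.path a).getVert i)).card ≤ 3 := by
  set s := (Finset.range ((L.path a).length + 1)).filter fun i => G.Adj w ((L.path a).getVert i)
  have mem_s {i} : i ∈ s ↔ i ≤ (L.path a).length ∧ G.Adj w ((L.path a).getVert i) := by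
    simp [s]
  obtain hs | hs := s.eq_empty_or_nonempty
  · simp [hs]
  obtain ⟨hlen, hadj⟩ := mem_s.1 (s.min'_mem hs)
  have hwindow : s ⊆ Finset.Icc (s.min' hs) (s.min' hs + 2) := fun j hj =>
    Finset.mem_Icc.2 ⟨s.min'_le j hj,
      L.le_add_two_of_adj hw hlen (mem_s.1 hj).1 hadj (mem_s.1 hj).2⟩
  refine (Finset.card_le_card hwindow).trans_eq ?_
  rw [Nat.card_Icc]
  omega

variable {L} in
theorem Inner.eq_of_mem {a b : ι} {x : V} (ha : L.Inner a x) (hb : x ∈ (L.path b).support) :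
    a = b := by
  by_contra hab
  obtain rfl | rfl := L.internallyDisjoint hab x ha.1 hb
  exacts [ha.2.1 rfl, ha.2.2 rfl]

variable {L} in
theorem Inner.notMem {a b : ι} {x : V} (ha : L.Inner a x) (hba : b ≠ a) :
    x ∉ (L.path b).support :=
  fun hb => hba (ha.eq_of_mem hb).symm

theorem inner_getVert {a : ι} {i : ℕ} (h0 : 0 < i) (hi : i < (L.path a).length) :
    L.Inner a ((L.path a).getVert i) := by
  refine ⟨L.getVert_mem_support a i, fun h => h0.ne' ?_, fun h => hi.ne ?_⟩
  · rwa [← L.getVert_inj hi.le (Nat.zero_le _), Walk.getVert_zero]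
  · rwa [← L.getVert_inj hi.le le_rfl, Walk.getVert_length]

theorem inner_innerVert (s : Σ a, Fin ((L.path a).length - 1)) : L.Inner s.1 (L.innerVert s) :=
  L.inner_getVert (Nat.succ_pos _) (by omega)

theorem innerVert_injective : Function.Injective L.innerVert := by
  rintro ⟨a, i⟩ ⟨b, j⟩ hij
  obtain rfl : a = b :=
    (L.inner_innerVert ⟨a, i⟩).eq_of_mem (hij ▸ (L.inner_innerVert ⟨b, j⟩).1)
  have hi : (i : ℕ) < (L.path a).length - 1 := i.2
  have hj : (j : ℕ) < (L.path a).length - 1 := j.2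
  have hij := (L.getVert_inj (a := a) (i := i + 1) (j := j + 1) (by omega) (by omega)).1 hij
  obtain rfl : i = j := Fin.ext (Nat.succ_injective hij)
  rfl

open Classical in
theorem card_outer_add_sum_le [Fintype V] [Fintype ι] [Nonempty ι] (hne : u ≠ v) :
    (Finset.univ.filter L.Outer).card + 2 + ∑ a, (L.path a).length ≤
      Fintype.card V + Fintype.card ι := by
  set I := Finset.univ.map ⟨L.innerVert, L.innerVert_injective⟩ with hI
  have hIcard : I.card + Fintype.card ι = ∑ a, (L.path a).length := by
    rw [hI, Finset.card_map, Finset.card_univ, Fintype.card_sigma, Fintype.card_eq_sum_ones,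
      ← Finset.sum_add_distrib]
    refine Finset.sum_congr rfl fun a _ => ?_
    rw [Fintype.card_fin]
    exact Nat.sub_add_cancel (Nat.one_le_iff_ne_zero.2 fun h => hne (Walk.eq_of_length_eq_zero h))
  have hends : Disjoint (Finset.univ.filter L.Outer) {u, v} := by
    obtain ⟨a⟩ := ‹Nonempty ι›
    have hu : ¬ L.Outer u := fun h => h a (Walk.start_mem_support _)
    have hv : ¬ L.Outer v := fun h => h a (Walk.end_mem_support _)
    simp [hu, hv]
  have hinner : Disjoint (Finset.univ.filter L.Outer ∪ {u, v}) I := by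
    refine Finset.disjoint_right.2 fun x hx hx' => ?_
    obtain ⟨s, -, rfl⟩ := Finset.mem_map.1 hx
    obtain ⟨hmem, hxu, hxv⟩ := L.inner_innerVert s
    simp only [Function.Embedding.coeFn_mk, Finset.mem_union, Finset.mem_filter, Finset.mem_univ,
      true_and, Finset.mem_insert, Finset.mem_singleton, hxu, hxv, or_self, or_false] at hx'
    exact hx' s.1 hmem
  calc (Finset.univ.filter L.Outer).card + 2 + ∑ a, (L.path a).length
      = (Finset.univ.filter L.Outer ∪ {u, v} ∪ I).card + Fintype.card ι := by
        rw [Finset.card_union_of_disjoint hinner, Finset.card_union_of_disjoint hends,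
          Finset.card_pair hne, add_assoc _ I.card, hIcard]
    _ ≤ Fintype.card V + Fintype.card ι := Nat.add_le_add_right (Finset.card_le_univ _) _

open Classical in
theorem card_outer_add_length_add_le [Fintype V] [Fintype ι] (hne : u ≠ v) (a : ι) :
    (Finset.univ.filter L.Outer).card + 2 + (L.path a).length + Fintype.card ι * G.dist u v ≤
      Fintype.card V + Fintype.card ι + G.dist u v := by
  have : Nonempty ι := ⟨a⟩
  have hothers : (Finset.univ.erase a).card * G.dist u v ≤
      ∑ b ∈ Finset.univ.erase a, (L.path b).length :=
    Finset.card_nsmul_le_sum _ _ _ fun b _ => dist_le (L.path b)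
  have hcard : ((Finset.univ.erase a).card + 1) * G.dist u v = Fintype.card ι * G.dist u v := by
    rw [Finset.card_erase_add_one (Finset.mem_univ a), Finset.card_univ]
  have hsum := L.card_outer_add_sum_le hne
  rw [← Finset.add_sum_erase _ _ (Finset.mem_univ a)] at hsum
  rw [add_one_mul] at hcard
  omega

theorem two_le_length (hd : 2 ≤ G.dist u v) (a : ι) : 2 ≤ (L.path a).length :=
  hd.trans (dist_le _)

theorem exists_inner (hd : 2 ≤ G.dist u v) (a : ι) : ∃ x, L.Inner a x :=
  ⟨_, L.inner_getVert one_pos (L.two_le_length hd a)⟩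

theorem exists_adj_notMem_path [Nontrivial ι] (hG : G.IsVertexConnected 3)
    (hd : 2 ≤ G.dist u v) {a : ι} {i : ℕ} (h0 : 0 < i) (hi : i < (L.path a).length) :
    ∃ y ∉ (L.path a).support, G.Adj ((L.path a).getVert i) y := by
  classical
  obtain ⟨b, hba⟩ := exists_ne a
  obtain ⟨t, ht⟩ := L.exists_inner hd b
  have htne (j : ℕ) : t ≠ (L.path a).getVert j := by
    rintro rfl
    exact ht.notMem hba.symm (L.getVert_mem_support a j)
  have hi' : (L.path a).getVert i ∉
      ({(L.path a).getVert (i - 1), (L.path a).getVert (i + 1)} : Finset V) := by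
    rw [Finset.mem_insert, Finset.mem_singleton, L.getVert_inj hi.le (by omega),
      L.getVert_inj hi.le (by omega)]
    omega
  obtain ⟨y, hy, hadj⟩ := exists_adj_notMem hG (Finset.card_le_two.trans_lt (by norm_num)) hi'
    (t := t) (by simp [htne]) (htne i).symm
  refine ⟨y, fun hmem => hy ?_, hadj⟩
  obtain ⟨j, rfl, hj⟩ := Walk.mem_support_iff_exists_getVert.1 hmem
  have hupper := L.le_add_one_of_adj hi.le hj hadj
  have hlower := L.le_add_one_of_adj hj hi.le hadj.symm
  have hself : j ≠ i := fun h => hadj.ne (h ▸ rfl)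
  obtain rfl | rfl : j = i - 1 ∨ j = i + 1 := by omega
  all_goals simp

theorem mem_support_of_mem_pathEdge {s : Σ a, Fin (L.path a).length} {x : V}
    (hx : x ∈ L.pathEdge s) : x ∈ (L.path s.1).support := by
  obtain rfl | rfl := Sym2.mem_iff.1 hx
  all_goals exact L.getVert_mem_support _ _

theorem exists_inner_mem_pathEdge (hd : 2 ≤ G.dist u v) (s : Σ a, Fin (L.path a).length) :
    ∃ x ∈ L.pathEdge s, L.Inner s.1 x := by
  have hlen := L.two_le_length hd s.1
  obtain hs | hs := Nat.eq_zero_or_pos s.2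
  · exact ⟨_, Sym2.mem_mk_right _ _, L.inner_getVert (Nat.succ_pos _) (by omega)⟩
  · exact ⟨_, Sym2.mem_mk_left _ _, L.inner_getVert hs s.2.2⟩

theorem pathEdge_injective (hd : 2 ≤ G.dist u v) : Function.Injective L.pathEdge := by
  intro s t hst
  obtain ⟨x, hxs, hx⟩ := L.exists_inner_mem_pathEdge hd s
  obtain ⟨a, i⟩ := s
  obtain ⟨b, j⟩ := t
  obtain rfl : a = b := hx.eq_of_mem (L.mem_support_of_mem_pathEdge (hst ▸ hxs))
  obtain rfl : i = j := by
    obtain ⟨h, -⟩ | ⟨h, h'⟩ := Sym2.eq_iff.1 hst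
    · exact Fin.ext ((L.getVert_inj i.2.le j.2.le).1 h)
    · have := (L.getVert_inj i.2.le j.2).1 h
      have := (L.getVert_inj i.2 j.2.le).1 h'
      omega
  rfl

theorem notMem_range_pathEdge {a : ι} {x y : V} (hx : L.Inner a x)
    (hy : y ∉ (L.path a).support) : s(x, y) ∉ Set.range L.pathEdge := by
  rintro ⟨s, hs⟩
  have hxs : x ∈ (L.path s.1).support :=
    L.mem_support_of_mem_pathEdge (hs ▸ Sym2.mem_mk_left x y)
  have hys : y ∈ (L.path s.1).support :=
    L.mem_support_of_mem_pathEdge (hs ▸ Sym2.mem_mk_right x y)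
  exact hy (hx.eq_of_mem hxs ▸ hys)

end GeodesicLinkage

/-! ### Rainbow colourings -/

theorem rainbowConnectionNumber_le_card [Fintype K] (C : G.edgeSet → K)
    (h : ∀ x y : V, ∃ q : G.Walk x y, Set.InjOn C {e | (e : Sym2 V) ∈ q.edges}) :
    G.rainbowConnectionNumber ≤ Fintype.card K := by
  classical
  refine Nat.sInf_le ⟨fun e => Fintype.equivFin K (C e), fun x y => ?_⟩
  obtain ⟨q, hq⟩ := h x y
  exact ⟨q.bypass, q.bypass_isPath, fun e f he hf hef =>
    hq (q.edges_bypass_subset_edges he) (q.edges_bypass_subset_edges hf)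
      ((Fintype.equivFin K).injective hef)⟩

/-- `x` and `y` are joined by a walk on which the edges outside `F` have pairwise distinct colours,
all of them in `S`. The edges in `F` are those that will receive private colours. -/
def RainbowJoined (G : SimpleGraph V) (F : Set (Sym2 V)) (col : Sym2 V → K) (S : Set K)
    (x y : V) : Prop :=
  ∃ q : G.Walk x y, Set.MapsTo col ({e | e ∈ q.edges} \ F) S ∧
    Set.InjOn col ({e | e ∈ q.edges} \ F)

namespace RainbowJoined

variable {F : Set (Sym2 V)} {col : Sym2 V → K} {S T : Set K} {x y z : V}

theorem refl (x : V) : RainbowJoined G F col ∅ x x :=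
  ⟨.nil, by simp [Set.MapsTo], by simp⟩

theorem symm (h : RainbowJoined G F col S x y) : RainbowJoined G F col S y x := by
  obtain ⟨q, hS, hq⟩ := h
  exact ⟨q.reverse, by simpa using hS, by simpa using hq⟩

theorem mono (hST : S ⊆ T) (h : RainbowJoined G F col S x y) : RainbowJoined G F col T x y := by
  obtain ⟨q, hS, hq⟩ := h
  exact ⟨q, hS.mono_right hST, hq⟩

theorem trans (hST : Disjoint S T) (hxy : RainbowJoined G F col S x y)
    (hyz : RainbowJoined G F col T y z) : RainbowJoined G F col (S ∪ T) x z := by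
  obtain ⟨q, hS, hq⟩ := hxy
  obtain ⟨r, hT, hr⟩ := hyz
  have hedges : {e | e ∈ (q.append r).edges} \ F =
      ({e | e ∈ q.edges} \ F) ∪ ({e | e ∈ r.edges} \ F) := by
    rw [← Set.union_sdiff_distrib]
    simp only [Walk.edges_append, List.mem_append, Set.ofPred_or]
  refine ⟨q.append r, hedges ▸ hS.union_union hT, ?_⟩
  rw [hedges]
  have hne {e f} (he : e ∈ {e | e ∈ q.edges} \ F) (hf : f ∈ {e | e ∈ r.edges} \ F) :
      col e ≠ col f := hST.ne_of_mem (hS he) (hT hf)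
  rintro e (he | he) f (hf | hf) hef
  exacts [hq he hf hef, absurd hef (hne he hf), absurd hef.symm (hne hf he), hr he hf hef]

theorem of_adj (h : G.Adj x y) : RainbowJoined G F col {col s(x, y)} x y := by
  refine ⟨h.toWalk, fun e he => ?_, fun e he f hf _ => ?_⟩
  · obtain rfl : e = s(x, y) := by simpa using he.1
    rfl
  · obtain rfl : e = s(x, y) := by simpa using he.1
    exact (by simpa using hf.1 : f = s(x, y)).symm

theorem of_adj_of_mem (h : G.Adj x y) (hF : s(x, y) ∈ F) : RainbowJoined G F col ∅ x y := by
  have hempty {e} : e ∉ {e | e ∈ h.toWalk.edges} \ F := by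
    rintro ⟨he, heF⟩
    obtain rfl : e = s(x, y) := by simpa using he
    exact heF hF
  exact ⟨h.toWalk, fun _ he => absurd he hempty, fun _ he => absurd he hempty⟩

theorem empty_trans (hxy : RainbowJoined G F col ∅ x y) (hyz : RainbowJoined G F col S y z) :
    RainbowJoined G F col S x z :=
  Set.empty_union S ▸ hxy.trans (Set.empty_disjoint S) hyz

theorem trans_empty (hxy : RainbowJoined G F col S x y) (hyz : RainbowJoined G F col ∅ y z) :
    RainbowJoined G F col S x z :=
  Set.union_empty S ▸ hxy.trans (Set.disjoint_empty S) hyz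

theorem getVert {p : G.Walk x y} {c : ℕ → K} {i j : ℕ} (hij : i ≤ j) (hj : j ≤ p.length)
    (hc : Set.InjOn c (Set.Ico i j))
    (hcol : ∀ m ∈ Set.Ico i j, col s(p.getVert m, p.getVert (m + 1)) = c m) :
    RainbowJoined G F col (c '' Set.Ico i j) (p.getVert i) (p.getVert j) := by
  induction j, hij using Nat.le_induction with
  | base => simpa using refl _
  | succ j hij ih =>
    have hIco : Set.Ico i (j + 1) = insert j (Set.Ico i j) := by
      ext m
      simp only [Set.mem_Ico, Set.mem_insert_iff]
      omega
    rw [hIco] at hc hcol ⊢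
    obtain ⟨hc, hcj⟩ := (Set.injOn_insert (by simp)).1 hc
    have hlast : RainbowJoined G F col {c j} (p.getVert j) (p.getVert (j + 1)) :=
      hcol j (Set.mem_insert _ _) ▸ of_adj (p.adj_getVert_succ hj)
    have hinit := ih (by omega) hc fun m hm => hcol m (Set.mem_insert_of_mem _ hm)
    rw [Set.image_insert_eq, ← Set.union_singleton]
    exact hinit.trans (Set.disjoint_singleton_right.2 hcj) hlast

end RainbowJoined

theorem rainbowConnectionNumber_le_card_add_card {S : Finset K} {F : Finset (Sym2 V)}
    {col : Sym2 V → K} (hS : ∀ e, col e ∈ S)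
    (h : ∀ x y, RainbowJoined G (F : Set (Sym2 V)) col S x y) :
    G.rainbowConnectionNumber ≤ S.card + F.card := by
  classical
  let C (e : G.edgeSet) : S ⊕ F :=
    if he : (e : Sym2 V) ∈ F then .inr ⟨e, he⟩ else .inl ⟨col e, hS e⟩
  have hcard : Fintype.card (S ⊕ F) = S.card + F.card := by simp
  rw [← hcard]
  refine rainbowConnectionNumber_le_card C fun x y => ?_
  obtain ⟨q, -, hq⟩ := h x y
  refine ⟨q, fun e he f hf hef => ?_⟩
  by_cases heF : (e : Sym2 V) ∈ F <;> by_cases hfF : (f : Sym2 V) ∈ F <;>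
    simp only [C, heF, hfF, dif_pos, not_false_eq_true, dif_neg, Sum.inl.injEq, Sum.inr.injEq,
      Subtype.mk.injEq, reduceCtorEq] at hef
  · exact Subtype.ext hef
  · exact Subtype.ext (hq ⟨he, heF⟩ ⟨hf, hfF⟩ hef)

theorem rainbowConnectionNumber_le_one_of_diam_le_one [Finite V] (hG : G.Connected)
    (h : G.diam ≤ 1) : G.rainbowConnectionNumber ≤ 1 := by
  refine rainbowConnectionNumber_le_card (K := Unit) (fun _ => ()) fun x y => ?_
  obtain rfl | hxy := eq_or_ne x y
  · exact ⟨.nil, by simp⟩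
  have := hG.nonempty
  have hdist : G.dist x y ≤ 1 := (dist_le_diam (connected_iff_ediam_ne_top.1 hG)).trans h
  have hadj : G.Adj x y := dist_eq_one_iff_adj.1 (hdist.antisymm (hG.pos_dist_of_ne hxy))
  refine ⟨hadj.toWalk, fun e he f hf _ => Subtype.ext ?_⟩
  have hmem {e : G.edgeSet} (he : (e : Sym2 V) ∈ hadj.toWalk.edges) : (e : Sym2 V) = s(x, y) := by
    simpa using he
  rw [hmem he, hmem hf]

/-! ### Colouring a geodesic linkage -/

namespace GeodesicLinkage

variable (L : GeodesicLinkage G u v ι) {dir : ι → Bool} {M : ℕ} {F : Set (Sym2 V)} {a b : ι}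
  {x y : V}

/-- The colouring that numbers the edges of each path from `u` to `v`: increasingly from `0` on the
paths `a` with `dir a = true`, decreasingly from `M - 1` on the others. All other edges get the
colour `M`. -/
noncomputable def level (dir : ι → Bool) (M : ℕ) : Sym2 V → ℕ :=
  Function.extend L.pathEdge (fun s => if dir s.1 then s.2 else M - 1 - s.2) fun _ => M

theorem level_getVert (hd : 2 ≤ G.dist u v) {i : ℕ} (hi : i < (L.path a).length) :
    L.level dir M s((L.path a).getVert i, (L.path a).getVert (i + 1)) =
      if dir a then i else M - 1 - i :=
  (L.pathEdge_injective hd).extend_apply _ _ ⟨a, i, hi⟩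

theorem level_of_notMem_range {e : Sym2 V} (he : e ∉ Set.range L.pathEdge) :
    L.level dir M e = M :=
  Function.extend_apply' _ _ _ he

theorem level_le (hM : ∀ a, (L.path a).length ≤ M) (e : Sym2 V) : L.level dir M e ≤ M := by
  classical
  rw [level, Function.extend_def]
  split_ifs with he
  · exact (he.choose.2.2.trans_le (hM _)).le
  · omega
  · exact le_rfl

theorem rainbowJoined_getVert_of_dir_eq_true (hd : 2 ≤ G.dist u v) (ha : dir a = true) {i j : ℕ}
    (hij : i ≤ j) (hj : j ≤ (L.path a).length) :
    RainbowJoined G F (L.level dir M) (Set.Ico i j) ((L.path a).getVert i)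
      ((L.path a).getVert j) := by
  rw [← Set.image_id (Set.Ico i j)]
  refine RainbowJoined.getVert hij hj (Set.injOn_id _) fun m hm => ?_
  rw [L.level_getVert hd (hm.2.trans_le hj), if_pos ha, id]

theorem rainbowJoined_getVert_of_dir_eq_false (hd : 2 ≤ G.dist u v)
    (hM : ∀ a, (L.path a).length ≤ M) (ha : dir a = false) {i j : ℕ} (hij : i ≤ j)
    (hj : j ≤ (L.path a).length) :
    RainbowJoined G F (L.level dir M) (Set.Ico (M - j) (M - i)) ((L.path a).getVert i)
      ((L.path a).getVert j) := by
  have hjM := hj.trans (hM a)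
  have hinj : Set.InjOn (fun m => M - 1 - m) (Set.Ico i j) := fun m hm n hn hmn => by
    obtain ⟨-, hm⟩ := hm
    obtain ⟨-, hn⟩ := hn
    dsimp only at hmn
    omega
  have himage : (fun m => M - 1 - m) '' Set.Ico i j ⊆ Set.Ico (M - j) (M - i) := by
    rintro _ ⟨m, ⟨him, hmj⟩, rfl⟩
    constructor <;> dsimp only <;> omega
  refine (RainbowJoined.getVert hij hj hinj fun m hm => ?_).mono himage
  rw [L.level_getVert hd (hm.2.trans_le hj), ha, if_neg Bool.false_ne_true]

theorem rainbowJoined_of_mem_of_mem (hd : 2 ≤ G.dist u v) (hM : ∀ a, (L.path a).length ≤ M)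
    (hx : x ∈ (L.path a).support) (hy : y ∈ (L.path a).support) :
    RainbowJoined G F (L.level dir M) (Set.Iio M) x y := by
  obtain ⟨i, rfl, hi⟩ := Walk.mem_support_iff_exists_getVert.1 hx
  obtain ⟨j, rfl, hj⟩ := Walk.mem_support_iff_exists_getVert.1 hy
  wlog hij : i ≤ j generalizing i j
  · exact (this j hj hy i hi hx (by omega)).symm
  cases ha : dir a
  · exact (L.rainbowJoined_getVert_of_dir_eq_false hd hM ha hij hj).mono
      fun m hm => hm.2.trans_le (Nat.sub_le M i)
  · exact (L.rainbowJoined_getVert_of_dir_eq_true hd ha hij hj).mono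
      fun m hm => hm.2.trans_le (hj.trans (hM a))

theorem rainbowJoined_of_dir_ne (hd : 2 ≤ G.dist u v) (hM : ∀ a, (L.path a).length ≤ M)
    (hab : dir a ≠ dir b) (hx : x ∈ (L.path a).support) (hy : y ∈ (L.path b).support) :
    RainbowJoined G F (L.level dir M) (Set.Iio M) x y := by
  wlog ha : dir a = true generalizing a b x y
  · exact (this hab.symm hy hx (by rw [Bool.eq_not_of_ne hab.symm]; simpa using ha)).symm
  have hb : dir b = false := by simpa [ha] using hab
  obtain ⟨i, rfl, hi⟩ := Walk.mem_support_iff_exists_getVert.1 hx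
  obtain ⟨j, rfl, hj⟩ := Walk.mem_support_iff_exists_getVert.1 hy
  have hlen := hM a
  obtain hij | hij := le_total i (M - j)
  · have hxu := (L.rainbowJoined_getVert_of_dir_eq_true (M := M) (F := F) hd ha i.zero_le hi).symm
    have huy := L.rainbowJoined_getVert_of_dir_eq_false (F := F) hd hM hb j.zero_le hj
    rw [Walk.getVert_zero] at hxu huy
    refine (hxu.trans (Set.Ico_disjoint_Ico.2 (by omega)) huy).mono fun m hm => ?_
    rw [Set.mem_union, Set.mem_Ico, Set.mem_Ico] at hm
    rw [Set.mem_Iio]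
    omega
  · have hxv := L.rainbowJoined_getVert_of_dir_eq_true (M := M) (F := F) hd ha hi le_rfl
    have hvy := (L.rainbowJoined_getVert_of_dir_eq_false (F := F) hd hM hb hj le_rfl).symm
    rw [Walk.getVert_length] at hxv hvy
    refine (hxv.trans (Set.Ico_disjoint_Ico.2 (by omega)) hvy).mono fun m hm => ?_
    rw [Set.mem_union, Set.mem_Ico, Set.mem_Ico] at hm
    rw [Set.mem_Iio]
    omega

/-- The vertex `t` of the path `a` is an end of the path or is joined to a vertex of another path by
a walk on which, up to edges of `F`, only the colour `M` occurs, and at most once. -/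
def IsExit (dir : ι → Bool) (M : ℕ) (F : Set (Sym2 V)) (a : ι) (t : V) : Prop :=
  t ∈ (L.path a).support ∧
    (L.Inner a t → ∃ b ≠ a, ∃ y ∈ (L.path b).support,
      RainbowJoined G F (L.level dir M) {M} t y)

variable {L}

theorem IsExit.rainbowJoined (hd : 2 ≤ G.dist u v) (hM : ∀ a, (L.path a).length ≤ M)
    (hdir : ∀ a b c, dir a = dir b → dir a = dir c → a = b ∨ a = c ∨ b = c)
    (hx : L.IsExit dir M F a x) (hy : y ∈ (L.path b).support) :
    RainbowJoined G F (L.level dir M) (Set.Iic M) x y := by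
  have hdirect {a x} (hab : a = b ∨ dir a ≠ dir b) (hx : x ∈ (L.path a).support) :
      RainbowJoined G F (L.level dir M) (Set.Iio M) x y := by
    obtain rfl | hab := hab
    exacts [L.rainbowJoined_of_mem_of_mem hd hM hx hy, L.rainbowJoined_of_dir_ne hd hM hab hx hy]
  by_cases hab : a = b ∨ dir a ≠ dir b
  · exact (hdirect hab hx.1).mono Set.Iio_subset_Iic_self
  push Not at hab
  by_cases hin : L.Inner a x
  · obtain ⟨c, hca, t, ht, hxt⟩ := hx.2 hin
    have hcb : c = b ∨ dir c ≠ dir b := by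
      by_contra! h
      obtain hab' | hac | hbc := hdir a b c hab.2 (hab.2.trans h.2.symm)
      exacts [hab.1 hab', hca hac.symm, h.1 hbc.symm]
    refine (hxt.trans ?_ (hdirect hcb ht)).mono ?_
    · simp
    · simp
  · have hend : x = u ∨ x = v := by
      by_contra! h
      exact hin ⟨hx.1, h⟩
    have hxb : x ∈ (L.path b).support := by
      obtain rfl | rfl := hend
      exacts [Walk.start_mem_support _, Walk.end_mem_support _]
    exact (hdirect (Or.inl rfl) hxb).mono Set.Iio_subset_Iic_self

theorem rainbowConnectionNumber_le_of_isExit (hd : 2 ≤ G.dist u v)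
    (hM : ∀ a, (L.path a).length ≤ M)
    (hdir : ∀ a b c, dir a = dir b → dir a = dir c → a = b ∨ a = c ∨ b = c)
    {F : Finset (Sym2 V)} (hF : ∀ x, ∃ a t, L.IsExit dir M F a t ∧
      RainbowJoined G (F : Set (Sym2 V)) (L.level dir M) ∅ x t) :
    G.rainbowConnectionNumber ≤ M + 1 + F.card := by
  rw [← Nat.card_Iic M]
  refine rainbowConnectionNumber_le_card_add_card
    (fun e => Finset.mem_Iic.2 (L.level_le (dir := dir) hM e)) fun x y => ?_
  obtain ⟨a, s, hs, hxs⟩ := hF x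
  obtain ⟨b, t, ht, hyt⟩ := hF y
  rw [Finset.coe_Iic]
  exact hxs.empty_trans ((hs.rainbowJoined hd hM hdir ht.1).trans_empty hyt.symm)

end GeodesicLinkage

/-! ### Private colours -/

/-- A forest in `G` with root set `P`, given by the parent of each vertex. The roots are their own
parents, and a vertex adjacent to a root must have a root as its parent. -/
structure SpanningForest (G : SimpleGraph V) (P : Set V) where
  parent : V → V
  depth : V → ℕ
  parent_of_mem : ∀ {x}, x ∈ P → parent x = x
  adj_parent : ∀ {x}, x ∉ P → G.Adj x (parent x)
  depth_parent_lt : ∀ {x}, x ∉ P → depth (parent x) < depth x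
  parent_mem : ∀ {x y}, y ∈ P → G.Adj x y → parent x ∈ P

theorem nonempty_spanningForest (hG : G.Connected) {P : Set V} (hP : P.Nonempty) :
    Nonempty (SpanningForest G P) := by
  classical
  obtain ⟨p, hp⟩ := hP
  let depth (x : V) : ℕ := if x ∈ P then 0 else G.dist x p + 1
  have hparent (x : V) : ∃ w, (x ∈ P → w = x) ∧
      (x ∉ P → G.Adj x w ∧ depth w < depth x ∧ ∀ y ∈ P, G.Adj x y → w ∈ P) := by
    by_cases hx : x ∈ P
    · exact ⟨x, fun _ => rfl, fun h => absurd hx h⟩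
    by_cases hroot : ∃ y ∈ P, G.Adj x y
    · obtain ⟨y, hy, hxy⟩ := hroot
      exact ⟨y, fun h => absurd h hx, fun _ => ⟨hxy, by simp [depth, hx, hy], fun _ _ _ => hy⟩⟩
    push Not at hroot
    obtain ⟨q, hq⟩ := hG.exists_walk_length_eq_dist x p
    cases q with
    | nil => exact absurd hp hx
    | @cons _ w _ hxw q =>
      refine ⟨w, fun h => absurd h hx, fun _ => ⟨hxw, ?_, fun y hy hxy => absurd hxy (hroot y hy)⟩⟩
      have hw : w ∉ P := fun h => hroot w h hxw
      have hdist := dist_le q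
      rw [Walk.length_cons] at hq
      simp only [depth, hx, hw, if_false]
      omega
  choose parent hmem hnotMem using hparent
  refine ⟨⟨parent, depth, fun h => hmem _ h, fun h => (hnotMem _ h).1, fun h => (hnotMem _ h).2.1,
    fun {x y} hy hxy => ?_⟩⟩
  by_cases hx : x ∈ P
  · exact (hmem x hx).symm ▸ hx
  · exact (hnotMem x hx).2.2 y hy hxy

namespace GeodesicLinkage

variable {L : GeodesicLinkage G u v ι} (T : SpanningForest G {x | ∃ a, L.Inner a x})
  {dir : ι → Bool} {M : ℕ} {a : ι} {x y : V}

theorem outer_of_not_inner (hx : ∀ a, ¬ L.Inner a x) (hxu : x ≠ u) (hxv : x ≠ v) : L.Outer x :=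
  fun a ha => hx a ⟨ha, hxu, hxv⟩

theorem Outer.not_inner (hx : L.Outer x) : ¬ L.Inner a x :=
  fun h => hx a h.1

theorem outer_of_inner_parent (hy : y ∉ (L.path a).support) (hpar : L.Inner a (T.parent y)) :
    L.Outer y := by
  refine outer_of_not_inner (fun b hb => hy ?_) ?_ ?_
  · rw [← T.parent_of_mem ⟨b, hb⟩]
    exact hpar.1
  · rintro rfl
    exact hy (Walk.start_mem_support _)
  · rintro rfl
    exact hy (Walk.end_mem_support _)

/-- An internal vertex is stuck if every edge that leaves its path ends at a vertex whose parent
lies on the same path. -/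
def Stuck (s : Σ a, Fin ((L.path a).length - 1)) : Prop :=
  ∀ y, G.Adj (L.innerVert s) y → y ∉ (L.path s.1).support → L.Inner s.1 (T.parent y)

open Classical in
/-- The edges with a private colour: those from the outer vertices to their parents, and those
preceding the stuck vertices on their paths. -/
noncomputable def privateEdges [Fintype V] [Fintype ι] : Finset (Sym2 V) :=
  (Finset.univ.filter L.Outer).image (fun w => s(w, T.parent w)) ∪
    (Finset.univ.filter (Stuck T)).image fun s =>
      s((L.path s.1).getVert s.2, (L.path s.1).getVert (s.2 + 1))

open Classical in
theorem card_adj_of_inner_parent_le_three [Fintype ι] (hy : L.Outer y) :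
    (Finset.univ.filter fun s : Σ a, Fin ((L.path a).length - 1) =>
      G.Adj y (L.innerVert s) ∧ L.Inner s.1 (T.parent y)).card ≤ 3 := by
  set N := Finset.univ.filter fun s : Σ a, Fin ((L.path a).length - 1) =>
    G.Adj y (L.innerVert s) ∧ L.Inner s.1 (T.parent y)
  have mem_N {s} : s ∈ N ↔ G.Adj y (L.innerVert s) ∧ L.Inner s.1 (T.parent y) := by simp [N]
  obtain hN | ⟨t, ht⟩ := N.eq_empty_or_nonempty
  · simp [hN]
  have hpath {s} (hs : s ∈ N) : s.1 = t.1 := (mem_N.1 hs).2.eq_of_mem (mem_N.1 ht).2.1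
  refine le_trans (Finset.card_le_card_of_injOn (fun s => (s.2 : ℕ) + 1) ?_ ?_)
    (L.card_adj_outer_le_three hy t.1)
  · intro s hs
    have hlen : (s.2 : ℕ) < (L.path t.1).length := by
      have := s.2.2
      rw [← hpath hs]
      omega
    have hadj : G.Adj y ((L.path t.1).getVert (s.2 + 1)) := hpath hs ▸ (mem_N.1 hs).1
    simp [hlen, hadj]
  · rintro ⟨a, i⟩ hs ⟨b, j⟩ ht hij
    obtain rfl : a = b := (hpath hs).trans (hpath ht).symm
    obtain rfl : i = j := Fin.ext (Nat.succ_injective hij)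
    rfl

open Classical in
theorem card_stuck_le [Fintype V] [Fintype ι] [Nontrivial ι] (hG : G.IsVertexConnected 3)
    (hd : 2 ≤ G.dist u v) :
    (Finset.univ.filter (Stuck T)).card ≤ 3 * (Finset.univ.filter L.Outer).card := by
  let N (y : V) := Finset.univ.filter fun s : Σ a, Fin ((L.path a).length - 1) =>
    G.Adj y (L.innerVert s) ∧ L.Inner s.1 (T.parent y)
  have hcover : Finset.univ.filter (Stuck T) ⊆ (Finset.univ.filter L.Outer).biUnion N := by
    intro s hs
    obtain ⟨y, hy, hadj⟩ := L.exists_adj_notMem_path hG hd (a := s.1) (i := s.2 + 1)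
      (Nat.succ_pos _) (by omega)
    have hpar : L.Inner s.1 (T.parent y) := (Finset.mem_filter.1 hs).2 y hadj hy
    exact Finset.mem_biUnion.2 ⟨y, by simpa using outer_of_inner_parent T hy hpar,
      by simpa [N] using ⟨hadj.symm, hpar⟩⟩
  refine (Finset.card_le_card hcover).trans ?_
  rw [mul_comm]
  exact Finset.card_biUnion_le_card_mul _ _ _ fun y hy =>
    card_adj_of_inner_parent_le_three T (Finset.mem_filter.1 hy).2

open Classical in
theorem card_privateEdges_le [Fintype V] [Fintype ι] [Nontrivial ι] (hG : G.IsVertexConnected 3)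
    (hd : 2 ≤ G.dist u v) :
    (privateEdges T).card ≤ 4 * (Finset.univ.filter L.Outer).card := by
  have hunion := Finset.card_union_le
    ((Finset.univ.filter L.Outer).image fun w => s(w, T.parent w))
    ((Finset.univ.filter (Stuck T)).image fun s =>
      s((L.path s.1).getVert s.2, (L.path s.1).getVert (s.2 + 1)))
  have houter := Finset.card_image_le (s := Finset.univ.filter L.Outer)
    (f := fun w => s(w, T.parent w))
  have hstuck := Finset.card_image_le (s := Finset.univ.filter (Stuck T))
    (f := fun s => s((L.path s.1).getVert s.2, (L.path s.1).getVert (s.2 + 1)))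
  have := card_stuck_le T hG hd
  rw [privateEdges]
  omega

theorem mem_privateEdges_of_outer [Fintype V] [Fintype ι] (hx : L.Outer x) :
    s(x, T.parent x) ∈ privateEdges T := by
  classical
  exact Finset.mem_union_left _ (Finset.mem_image.2 ⟨x, by simpa using hx, rfl⟩)

theorem mem_privateEdges_of_stuck [Fintype V] [Fintype ι]
    {s : Σ a, Fin ((L.path a).length - 1)} (hs : Stuck T s) :
    s((L.path s.1).getVert s.2, (L.path s.1).getVert (s.2 + 1)) ∈ privateEdges T := by
  classical
  exact Finset.mem_union_right _ (Finset.mem_image.2 ⟨s, by simpa using hs, rfl⟩)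

theorem rainbowJoined_parent_of_outer [Fintype V] [Fintype ι] (hx : L.Outer x) {col : Sym2 V → K} :
    RainbowJoined G (privateEdges T : Set (Sym2 V)) col ∅ x (T.parent x) :=
  .of_adj_of_mem (T.adj_parent fun ⟨_, h⟩ => hx.not_inner h)
    (Finset.mem_coe.2 (mem_privateEdges_of_outer T hx))

theorem isExit_of_not_stuck [Fintype V] [Fintype ι] {s : Σ a, Fin ((L.path a).length - 1)}
    (hs : ¬ Stuck T s) : L.IsExit dir M (privateEdges T) s.1 (L.innerVert s) := by
  have hin := L.inner_innerVert s
  refine ⟨hin.1, fun _ => ?_⟩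
  rw [Stuck] at hs
  push Not at hs
  obtain ⟨y, hadj, hy, hpar⟩ := hs
  obtain ⟨b, hb⟩ := T.parent_mem ⟨s.1, hin⟩ hadj.symm
  have hleave : RainbowJoined G (privateEdges T : Set (Sym2 V)) (L.level dir M) {M}
      (L.innerVert s) y :=
    (RainbowJoined.of_adj hadj).mono (Set.singleton_subset_singleton.2
      (L.level_of_notMem_range (L.notMem_range_pathEdge hin hy)))
  refine ⟨b, fun hbs => hpar (hbs ▸ hb), _, hb.1, hleave.trans_empty ?_⟩
  by_cases hyP : ∃ a, L.Inner a y
  · exact (T.parent_of_mem hyP).symm ▸ .refl y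
  · refine rainbowJoined_parent_of_outer T (outer_of_not_inner (not_exists.1 hyP) ?_ ?_)
    all_goals rintro rfl
    exacts [hy (Walk.start_mem_support _), hy (Walk.end_mem_support _)]

theorem exists_isExit_of_mem_path [Fintype V] [Fintype ι] (hx : x ∈ (L.path a).support) :
    ∃ t, L.IsExit dir M (privateEdges T) a t ∧
      RainbowJoined G (privateEdges T : Set (Sym2 V)) (L.level dir M) ∅ x t := by
  obtain ⟨i, rfl, hi⟩ := Walk.mem_support_iff_exists_getVert.1 hx
  clear hx
  induction i with
  | zero =>
    rw [Walk.getVert_zero]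
    exact ⟨u, ⟨Walk.start_mem_support _, fun h => absurd rfl h.2.1⟩, .refl u⟩
  | succ i ih =>
    obtain hi | hi := hi.eq_or_lt
    · rw [hi, Walk.getVert_length]
      exact ⟨v, ⟨Walk.end_mem_support _, fun h => absurd rfl h.2.2⟩, .refl v⟩
    let s : Σ a, Fin ((L.path a).length - 1) := ⟨a, i, by omega⟩
    by_cases hs : Stuck T s
    · obtain ⟨t, ht, hit⟩ := ih (by omega)
      have hback := (L.path a).adj_getVert_succ (i := i) (by omega)
      exact ⟨t, ht, (RainbowJoined.of_adj_of_mem hback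
        (Finset.mem_coe.2 (mem_privateEdges_of_stuck T hs))).symm.empty_trans hit⟩
    · exact ⟨_, isExit_of_not_stuck T hs, .refl _⟩

theorem exists_isExit [Fintype V] [Fintype ι] (x : V) :
    ∃ a t, L.IsExit dir M (privateEdges T) a t ∧
      RainbowJoined G (privateEdges T : Set (Sym2 V)) (L.level dir M) ∅ x t := by
  induction hn : T.depth x using Nat.strong_induction_on generalizing x with
  | _ n ih =>
    subst hn
    by_cases hx : L.Outer x
    · obtain ⟨a, t, ht, hxt⟩ := ih _ (T.depth_parent_lt fun ⟨_, h⟩ => hx.not_inner h) _ rfl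
      exact ⟨a, t, ht, (rainbowJoined_parent_of_outer T hx).empty_trans hxt⟩
    · rw [Outer] at hx
      push Not at hx
      exact ⟨_, exists_isExit_of_mem_path T hx.choose_spec⟩

open Classical in
theorem rainbowConnectionNumber_le [Fintype V] [Finite ι] [Nontrivial ι]
    (L : GeodesicLinkage G u v ι) (hG : G.IsVertexConnected 3) (hd : 2 ≤ G.dist u v)
    (hM : ∀ a, (L.path a).length ≤ M)
    (hdir : ∀ a b c, dir a = dir b → dir a = dir c → a = b ∨ a = c ∨ b = c) :
    G.rainbowConnectionNumber ≤ M + 1 + 4 * (Finset.univ.filter L.Outer).card := by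
  have := Fintype.ofFinite ι
  obtain ⟨a⟩ : Nonempty ι := inferInstance
  obtain ⟨x, hx⟩ := L.exists_inner hd a
  obtain ⟨T⟩ := nonempty_spanningForest hG.1 (P := {x | ∃ a, L.Inner a x}) ⟨x, a, hx⟩
  exact (rainbowConnectionNumber_le_of_isExit hd hM hdir (exists_isExit T)).trans
    (Nat.add_le_add_left (card_privateEdges_le T hG hd) _)

end GeodesicLinkage

theorem rainbowConnectionNumber_add_le_of_two_le_diam [Fintype V] {k : ℕ}
    (hG : G.IsVertexConnected k) (hk3 : 3 ≤ k) (hk4 : k ≤ 4) (hdiam : 2 ≤ G.diam) :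
    G.rainbowConnectionNumber + 4 * (k * G.diam) + 7 ≤ G.diam + 4 * Fintype.card V + 4 * k := by
  classical
  have := hG.1.nonempty
  obtain ⟨u, v, huv⟩ := G.exists_dist_eq_diam
  rw [← huv] at hdiam ⊢
  have hne : u ≠ v := by
    rintro rfl
    simp at hdiam
  have hadj : ¬ G.Adj u v := fun h => by
    rw [dist_eq_one_iff_adj.2 h] at hdiam
    omega
  obtain ⟨L⟩ := nonempty_geodesicLinkage (ι := Fin k) (by rwa [Fintype.card_fin]) hne hadj
  have : Nontrivial (Fin k) := Fin.nontrivial_iff_two_le.2 (by omega)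
  have hdir (a b c : Fin k) : decide ((a : ℕ) < 2) = decide ((b : ℕ) < 2) →
      decide ((a : ℕ) < 2) = decide ((c : ℕ) < 2) → a = b ∨ a = c ∨ b = c := by
    simp only [decide_eq_decide, Fin.ext_iff]
    omega
  obtain ⟨a, ha⟩ := Finite.exists_max fun a => (L.path a).length
  have hrc := L.rainbowConnectionNumber_le (isVertexConnected_mono hk3 hG) hdiam ha hdir
  have hcard := L.card_outer_add_length_add_le hne a
  have hlen : G.dist u v ≤ (L.path a).length := dist_le _
  rw [Fintype.card_fin] at hcard
  omega

theorem rainbowConnectionNumber_add_le [Fintype V] {k : ℕ} (hG : G.IsVertexConnected k)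
    (hk3 : 3 ≤ k) (hk4 : k ≤ 4) :
    G.rainbowConnectionNumber + 4 * (k * G.diam) + 7 ≤ G.diam + 4 * Fintype.card V + 4 * k := by
  obtain hdiam | hdiam := le_or_gt G.diam 1
  · have hrc := rainbowConnectionNumber_le_one_of_diam_le_one hG.1 hdiam
    obtain h0 | h1 : G.diam = 0 ∨ G.diam = 1 := by omega
    · rw [h0]
      omega
    · have := nontrivial_of_diam_ne_zero (h1.trans_ne one_ne_zero)
      have := Fintype.one_lt_card (α := V)
      rw [h1]
      omega
  · exact rainbowConnectionNumber_add_le_of_two_le_diam hG hk3 hk4 hdiam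

end RainbowConnection

theorem mainTheorem1_general {V : Type*} [Fintype V] {G : SimpleGraph V} {κ : ℕ} {c : ℝ}
    (hκ3 : 3 ≤ κ) (hκ4 : κ ≤ 4) (hG : G.IsVertexConnected κ)
    (hdiam : (G.diam : ℝ) = (Fintype.card V : ℝ) / (κ : ℝ) - c) :
    (G.rainbowConnectionNumber : ℝ) ≤
      (Fintype.card V : ℝ) / (κ : ℝ) + (4 * κ - 1) * c + (4 * κ - 7) := by
  have hrc : (G.rainbowConnectionNumber : ℝ) + 4 * (κ * G.diam) + 7 ≤
      G.diam + 4 * Fintype.card V + 4 * κ := by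
    exact_mod_cast RainbowConnection.rainbowConnectionNumber_add_le hG hκ3 hκ4
  have hκ : (κ : ℝ) ≠ 0 := Nat.cast_ne_zero.2 (by omega)
  have hmul : (κ : ℝ) * G.diam = Fintype.card V - κ * c := by
    rw [hdiam, mul_sub, mul_div_cancel₀ _ hκ]
  linarith

theorem mainTheorem1 {V : Type*} [Fintype V] (G : SimpleGraph V) (κ : ℕ) (c : ℝ)
    (hG : G.IsVertexConnected κ) (hc : 0 ≤ c)
    (hdiam : (G.diam : ℝ) = (Fintype.card V : ℝ) / (κ : ℝ) - c) :
    (κ = 3 → (G.rainbowConnectionNumber : ℝ) ≤ (Fintype.card V : ℝ) / 3 + 11 * c + 6) ∧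
    (κ = 4 → (G.rainbowConnectionNumber : ℝ) ≤ (Fintype.card V : ℝ) / 4 + 15 * c + 18) := by
  constructor <;> rintro rfl <;>
    linarith [mainTheorem1_general (by norm_num) (by norm_num) hG hdiam]
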